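/- Let $G$ be a finite connected simple graph with vertex set $V$, $|V|=n$, and let $T$ be a spanning tree of $G$. A partial orientation of $G$ with respect to $T$ is a skew-symmetric map $\sigma$, with values in $\{0,1,-1\}$, on the ordered pairs of vertices that are not edges of $T$, such that $\sigma(u,v)\neq 0$ if and only if $\{u,v\}\in E(G)$. The Hermitian adjacency matrix $H(G_T^\sigma)=(h_{uv})_{u,v\in V}$ has $h_{uv}=1$ if $\{u,v\}\in E(T)$, $h_{uv}=\mathrm{i}\,\sigma(u,v)$ if $\{u,v\}\in E(G)\setminus E(T)$, and $h_{uv}=0$ otherwise, where $\mathrm{i}=\sqrt{-1}$. Let $e_1,\dots,e_m$ be an arbitrary enumeration, without repetition, of the edges in $E(G)\setminus E(T)$, and write $e_i=\{u_i,v_i\}$ with an arbitrarily specified end vertex $u_i$. The rule $s_i=\sigma(u_i,v_i)$ is a bijection between the partial orientations $\sigma$ of $G$ with respect to $T$ and the sign vectors $(s_1,\dots,s_m)\in\{-1,1\}^m$; for corresponding $\sigma$ and $(s_1,\dots,s_m)$ put $$f_{s_1,\dots,s_m}(x)=\det\bigl(xI-H(G_T^\sigma)\bigr).$$ For $0\le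 k\le m$ and $(s_1,\dots,s_k)\in\{-1,1\}^k$ put $$f_{s_1,\dots,s_k}=\sum_{s_{k+1},\dots,s_m\in\{-1,1\}} f_{s_1,\dots,s_k,s_{k+1},\dots,s_m}.$$ Then the polynomials $f_{s_1,\dots,s_m}$ form an interlacing family. That is: 1. all the $f_{s_1,\dots,s_m}$ have only real coefficients and only real roots, the same degree, and positive leading coefficients; 2. for every $k\in\{0,\dots,m-1\}$ and every $(s_1,\dots,s_k)\in\{-1,1\}^k$, the two polynomials $f_{s_1,\dots,s_k,1}$ and $f_{s_1,\dots,s_k,-1}$ have a common interlacing, i.e. there is one polynomial $g$ that interlaces both of them. Here a polynomial $g(x)=\prod_{j=1}^{d-1}(x-\alpha_j)$ with real roots interlaces a polynomial $f(x)=c\prod_{j=1}^{d}(x-\beta_j)$ with $c>0$ and real roots, $d\ge 1$, if the roots can be numbered so that $\beta_1\le\alpha_1\le\beta_2\le\alpha_2\le\dots\le\alpha_{d-1}\le\beta_d$. -/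

import Mathlib

open Polynomial

/-- A univariate polynomial is real-rooted if all its coefficients and all its roots are real. -/
def RealRooted (p : ℂ[X]) : Prop :=
  (∀ k, (p.coeff k).im = 0) ∧ ∀ z : ℂ, p.IsRoot z → z.im = 0

/-- `Interlaces g f`: for some `n = d + 1 ≥ 1` we have `g = ∏_{j < n - 1} (x - α_j)` and, up to a
positive leading coefficient `c`, `f = c ∏_{j < n} (x - β_j)`, with all `α_j, β_j` real and
`β_0 ≤ α_0 ≤ β_1 ≤ α_1 ≤ ⋯ ≤ α_{n - 2} ≤ β_{n - 1}`. -/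
def Interlaces (g f : ℂ[X]) : Prop :=
  ∃ (d : ℕ) (α : Fin d → ℝ) (β : Fin (d + 1) → ℝ) (c : ℝ), 0 < c ∧
    g = ∏ j, (X - C (α j : ℂ)) ∧
    f = C (c : ℂ) * ∏ j, (X - C (β j : ℂ)) ∧
    ∀ j : Fin d, β j.castSucc ≤ α j ∧ α j ≤ β j.succ

/-- A family of polynomials has a common interlacing if one polynomial interlaces all of them. -/
def HasCommonInterlacing {ι : Type*} (f : ι → ℂ[X]) : Prop :=
  ∃ g : ℂ[X], ∀ i, Interlaces g (f i)

open Classical in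
/-- The polynomial `f_{s_1, …, s_k}` of a partial assignment `(s_1, …, s_k)`, `k ≤ m`: the sum of
`f_{t_1, …, t_m}` over all full assignments `t` that extend `s`. -/
noncomputable def partialSum {m : ℕ} {S : Fin m → Type*} [∀ i, Fintype (S i)]
    (f : (∀ i, S i) → ℂ[X]) (k : ℕ) (hk : k ≤ m) (s : ∀ i : Fin k, S (Fin.castLE hk i)) : ℂ[X] :=
  ∑ t : (∀ i, S i) with ∀ i : Fin k, t (Fin.castLE hk i) = s i, f t

/-- Interlacing families: the `f_{s_1, …, s_m}` are real-rooted, of one common degree, with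
positive leading coefficients, and for every `k < m` and every partial assignment
`(s_1, …, s_k)` the polynomials `f_{s_1, …, s_k, t}`, `t ∈ S_{k + 1}`, have a common
interlacing. -/
def IsInterlacingFamily {m : ℕ} {S : Fin m → Type*} [∀ i, Fintype (S i)]
    (f : (∀ i, S i) → ℂ[X]) : Prop :=
  (∃ n : ℕ, ∀ s, RealRooted (f s) ∧ (f s).natDegree = n ∧
      ∃ c : ℝ, 0 < c ∧ (f s).leadingCoeff = (c : ℂ)) ∧
  ∀ (k : ℕ) (hk : k < m) (s : ∀ i : Fin k, S (Fin.castLE hk.le i)),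
    HasCommonInterlacing (fun t : S ⟨k, hk⟩ =>
      partialSum f (k + 1) hk
        (Fin.snoc (α := fun i : Fin (k + 1) => S (Fin.castLE hk i)) s t))

/-- An orientation of `G` with respect to (the edge set of) `T`: a skew-symmetric map `σ` with
values in `{0, 1, -1}` that is nonzero exactly on the edges of `G` outside `T`. It is extended by
`0` to the ordered pairs that are edges of `T`. -/
@[ext] structure PartialOrientation {V : Type*} (G T : SimpleGraph V) where
  σ : V → V → ℤ
  mem_values : ∀ u v, σ u v ∈ ({0, 1, -1} : Set ℤ)
  skew : ∀ u v, σ u v = -σ v u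
  ne_zero_iff : ∀ u v, σ u v ≠ 0 ↔ G.Adj u v ∧ ¬ T.Adj u v

open Classical in
/-- The Hermitian adjacency matrix of the mixed graph in which the edges of `T` are undirected and
the other edges of `G` are oriented by `σ`. -/
noncomputable def hermitianAdjMatrix {V : Type*} {G T : SimpleGraph V}
    (σ : PartialOrientation G T) : Matrix V V ℂ :=
  Matrix.of fun u v =>
    if T.Adj u v then 1
    else if G.Adj u v then Complex.I * (σ.σ u v : ℂ)
    else 0

/-- An enumeration `e_i = {u_i, v_i}`, `i < m`, without repetition, of the edges of `G` outside
`T`, with a specified end vertex `u_i` of each of them. -/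
structure OutsideEdges {V : Type*} (G T : SimpleGraph V) (m : ℕ) where
  u : Fin m → V
  v : Fin m → V
  injective : Function.Injective fun i => s(u i, v i)
  range_eq : (Set.range fun i => s(u i, v i)) = G.edgeSet \ T.edgeSet

/-- The set of signs `{-1, 1}`. -/
abbrev Signs : Type := ({-1, 1} : Finset ℤ)

namespace OutsideEdges

variable {V : Type*} {G T : SimpleGraph V} {m : ℕ}

theorem adj (e : OutsideEdges G T m) (i : Fin m) :
    G.Adj (e.u i) (e.v i) ∧ ¬ T.Adj (e.u i) (e.v i) := by
  have h : s(e.u i, e.v i) ∈ G.edgeSet \ T.edgeSet := e.range_eq ▸ ⟨i, rfl⟩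
  simpa using h

theorem exists_index (e : OutsideEdges G T m) {x y : V} (h : G.Adj x y) (h' : ¬ T.Adj x y) :
    ∃ i, (e.u i = x ∧ e.v i = y) ∨ (e.u i = y ∧ e.v i = x) := by
  have h2 : s(x, y) ∈ G.edgeSet \ T.edgeSet := by simpa using ⟨h, h'⟩
  rw [← e.range_eq] at h2
  obtain ⟨i, hi⟩ := h2
  exact ⟨i, by simpa using hi⟩

theorem sign_mem (e : OutsideEdges G T m) (σ : PartialOrientation G T) (i : Fin m) :
    σ.σ (e.u i) (e.v i) ∈ ({-1, 1} : Finset ℤ) := by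
  have h1 := σ.mem_values (e.u i) (e.v i)
  have h2 := (σ.ne_zero_iff (e.u i) (e.v i)).2 (e.adj i)
  simp only [Set.mem_insert_iff, Set.mem_singleton_iff, Finset.mem_insert,
    Finset.mem_singleton] at h1 ⊢
  tauto

/-- The rule `s_i = σ(u_i, v_i)`. -/
def signsOf (e : OutsideEdges G T m) (σ : PartialOrientation G T) : Fin m → Signs :=
  fun i => ⟨σ.σ (e.u i) (e.v i), e.sign_mem σ i⟩

theorem signsOf_injective (e : OutsideEdges G T m) : Function.Injective e.signsOf := by
  intro σ τ h
  have key : ∀ i, σ.σ (e.u i) (e.v i) = τ.σ (e.u i) (e.v i) := fun i =>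
    congrArg Subtype.val (congrFun h i)
  ext x y
  by_cases hxy : G.Adj x y ∧ ¬ T.Adj x y
  · obtain ⟨i, ⟨rfl, rfl⟩ | ⟨rfl, rfl⟩⟩ := e.exists_index hxy.1 hxy.2
    · exact key i
    · rw [σ.skew, τ.skew, key i]
  · have h1 := (σ.ne_zero_iff x y).not.2 hxy
    have h2 := (τ.ne_zero_iff x y).not.2 hxy
    rw [not_not] at h1 h2
    rw [h1, h2]

theorem signsOf_surjective (e : OutsideEdges G T m) : Function.Surjective e.signsOf := by
  classical
  intro s
  have hs : ∀ i, (s i : ℤ) = -1 ∨ (s i : ℤ) = 1 := fun i => by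
    obtain ⟨a, ha⟩ := s i
    simpa using ha
  have ne : ∀ i, e.u i ≠ e.v i := fun i => (e.adj i).1.ne
  have uniq : ∀ i j, (e.u i = e.u j ∧ e.v i = e.v j) ∨ (e.u i = e.v j ∧ e.v i = e.u j) →
      i = j := fun i j h => e.injective (by simpa using h)
  let F : V → V → ℤ := fun x y =>
    if h : ∃ i, e.u i = x ∧ e.v i = y then (s h.choose : ℤ)
    else if h : ∃ i, e.u i = y ∧ e.v i = x then -(s h.choose : ℤ) else 0
  have F1 : ∀ i, F (e.u i) (e.v i) = s i := by
    intro i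
    have h : ∃ j, e.u j = e.u i ∧ e.v j = e.v i := ⟨i, rfl, rfl⟩
    have hj : h.choose = i := uniq _ _ (Or.inl h.choose_spec)
    simp only [F, dif_pos h, hj]
  have F2 : ∀ i, F (e.v i) (e.u i) = -(s i : ℤ) := by
    intro i
    have h0 : ¬ ∃ j, e.u j = e.v i ∧ e.v j = e.u i := by
      rintro ⟨j, hj⟩
      obtain rfl := uniq _ _ (Or.inr hj)
      exact ne j hj.1
    have h : ∃ j, e.u j = e.u i ∧ e.v j = e.v i := ⟨i, rfl, rfl⟩
    have hj : h.choose = i := uniq _ _ (Or.inl h.choose_spec)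
    simp only [F, dif_neg h0, dif_pos h, hj]
  have F0 : ∀ x y, ¬ (G.Adj x y ∧ ¬ T.Adj x y) → F x y = 0 := by
    intro x y h
    have h1 : ¬ ∃ j, e.u j = x ∧ e.v j = y := by
      rintro ⟨j, rfl, rfl⟩
      exact h (e.adj j)
    have h2 : ¬ ∃ j, e.u j = y ∧ e.v j = x := by
      rintro ⟨j, rfl, rfl⟩
      exact h ⟨(e.adj j).1.symm, fun h' => (e.adj j).2 h'.symm⟩
    simp only [F, dif_neg h1, dif_neg h2]
  have symm : ∀ x y, ¬ (G.Adj x y ∧ ¬ T.Adj x y) → ¬ (G.Adj y x ∧ ¬ T.Adj y x) :=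
    fun x y h h' => h ⟨h'.1.symm, fun h'' => h'.2 h''.symm⟩
  refine ⟨⟨F, ?_, ?_, ?_⟩, ?_⟩
  · intro x y
    by_cases h : G.Adj x y ∧ ¬ T.Adj x y
    · obtain ⟨i, ⟨rfl, rfl⟩ | ⟨rfl, rfl⟩⟩ := e.exists_index h.1 h.2
      · rw [F1]; rcases hs i with h | h <;> simp [h]
      · rw [F2]; rcases hs i with h | h <;> simp [h]
    · simp [F0 x y h]
  · intro x y
    by_cases h : G.Adj x y ∧ ¬ T.Adj x y
    · obtain ⟨i, ⟨rfl, rfl⟩ | ⟨rfl, rfl⟩⟩ := e.exists_index h.1 h.2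
      · rw [F1, F2, neg_neg]
      · rw [F1, F2]
    · rw [F0 x y h, F0 y x (symm x y h), neg_zero]
  · intro x y
    by_cases h : G.Adj x y ∧ ¬ T.Adj x y
    · refine iff_of_true ?_ h
      obtain ⟨i, ⟨rfl, rfl⟩ | ⟨rfl, rfl⟩⟩ := e.exists_index h.1 h.2
      · rw [F1]; rcases hs i with h | h <;> simp [h]
      · rw [F2]; rcases hs i with h | h <;> simp [h]
    · exact iff_of_false (not_not.2 (F0 x y h)) h
  · funext i
    exact Subtype.ext (F1 i)

/-- The bijective correspondence `σ ↔ (s_1, …, s_m)`, `s_i = σ(u_i, v_i)`, between the orientations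
of `G` with respect to `T` and the sign vectors. -/
noncomputable def correspondence (e : OutsideEdges G T m) :
    PartialOrientation G T ≃ (Fin m → Signs) :=
  Equiv.ofBijective e.signsOf ⟨e.signsOf_injective, e.signsOf_surjective⟩

/-- `f_{s_1, …, s_m}(x) = det(x I - H)`, where `H` is the Hermitian adjacency matrix for the
orientation that corresponds to the sign vector `s`. -/
noncomputable def signPoly [Fintype V] [DecidableEq V] (e : OutsideEdges G T m)
    (s : Fin m → Signs) : ℂ[X] :=
  (hermitianAdjMatrix (e.correspondence.symm s)).charpoly

end OutsideEdges

/-! Each outside edge `j` contributes `± E_j` to the Hermitian adjacency matrix, with `E_j` its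
`edgeMatrix`. So a partial sum is the sum of the characteristic polynomials of `N ± E_{k+1} ± ⋯ ±
E_m` for one Hermitian `N`.

Stability: replace `x I` by `diag z`. For dissipative `N`, `det (diag z - N)` has no zero with all
`Im z_v > 0`. Adding the terms for `N + E_uv` and `N - E_uv` applies `2 (1 - ∂ᵤ∂ᵥ)`, which preserves
this (`sub_add_ne_zero_of_stable`). Hence every signed sum is zero-free there, and real-rooted for
Hermitian `N`.

Interlacing: both `N ± E_uv` have the form `N' + w wᴴ` with the same `N'`. If `q`, `f` are the
signed sums at `N'` and `N' + w wᴴ`, the one at `N' + r w wᴴ` is `(1 - r) q + r f`; stability for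
`Im r ≤ 0` forces `Im (f / q) ≥ 0` on the upper half plane. Following the argument of `f / q` down
to the real axis, to the right of a real point `f` has as many roots as `q` or one more. So the
roots alternate, and `q` without its smallest root serves both signs. -/

/-! ### Arguments of products of linear factors on the upper half plane -/

open Filter Topology in
theorem Complex.tendsto_arg_add_mul_I_nhdsGT {a : ℝ} (ha : a ≠ 0) :
    Tendsto (fun y : ℝ => ((a : ℂ) + y * Complex.I).arg) (𝓝[>] 0)
      (𝓝 (if 0 < a then 0 else Real.pi)) := by
  have hc : Continuous fun y : ℝ => (a : ℂ) + y * Complex.I := by fun_prop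
  have h0 : Tendsto (fun y : ℝ => (a : ℂ) + y * Complex.I) (𝓝[>] 0) (𝓝 (a : ℂ)) := by
    simpa using (hc.tendsto 0).mono_left nhdsWithin_le_nhds
  split_ifs with h
  · have h1 : ContinuousAt Complex.arg (a : ℂ) :=
      Complex.continuousAt_arg (by simp [Complex.mem_slitPlane_iff, h])
    have := h1.tendsto.comp h0
    rwa [Complex.arg_ofReal_of_nonneg h.le] at this
  · have h1 := Complex.tendsto_arg_nhdsWithin_im_nonneg_of_re_neg_of_im_zero
      (z := (a : ℂ)) (by simpa using lt_of_le_of_ne (not_lt.1 h) ha) (by simp)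
    refine h1.comp (tendsto_nhdsWithin_iff.2 ⟨h0, ?_⟩)
    filter_upwards [self_mem_nhdsWithin] with y hy
    simpa using le_of_lt hy

open Filter Topology in
theorem Complex.tendsto_arg_mul_I_sub_atTop (a : ℝ) :
    Tendsto (fun y : ℝ => ((y : ℂ) * Complex.I - a).arg) atTop (𝓝 (Real.pi / 2)) := by
  have h1 : Tendsto (fun y : ℝ => Complex.I - ((a / y : ℝ) : ℂ)) atTop (𝓝 Complex.I) := by
    have h2 : Tendsto (fun y : ℝ => a / y) atTop (𝓝 0) := tendsto_const_nhds.div_atTop tendsto_id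
    have h3 := (Complex.continuous_ofReal.tendsto 0).comp h2
    simpa using (tendsto_const_nhds (x := Complex.I)).sub h3
  have h4 : ContinuousAt Complex.arg Complex.I :=
    Complex.continuousAt_arg (by simp [Complex.mem_slitPlane_iff])
  have h5 := h4.tendsto.comp h1
  rw [Complex.arg_I] at h5
  refine h5.congr' ?_
  filter_upwards [eventually_gt_atTop 0] with y hy
  have hy' : (y : ℂ) ≠ 0 := by exact_mod_cast hy.ne'
  have : (y : ℂ) * Complex.I - a = y * (Complex.I - ((a / y : ℝ) : ℂ)) := by
    push_cast; field_simp
  rw [this, Complex.arg_real_mul _ hy]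
  rfl

theorem Complex.prod_eq_prod_norm_mul_exp_sum_arg {ι : Type*} (s : Finset ι) (f : ι → ℂ) :
    ∏ j ∈ s, f j = ((∏ j ∈ s, ‖f j‖ : ℝ) : ℂ) *
      Complex.exp (((∑ j ∈ s, (f j).arg : ℝ) : ℂ) * Complex.I) := by
  push_cast
  rw [Finset.sum_mul, Complex.exp_sum, ← Finset.prod_mul_distrib]
  exact Finset.prod_congr rfl fun j _ => (Complex.norm_mul_exp_arg_mul_I _).symm

/-- If a quotient of two products of `n` real linear factors maps the upper half plane to its
closure, then the total argument of the quotient lies in `[0, π]`. -/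
theorem sum_arg_sub_sum_arg_mem_Icc {n : ℕ} {β γ : Fin n → ℝ}
    (h : ∀ z : ℂ, 0 < z.im → 0 ≤ ((∏ j, (z - β j)) / ∏ j, (z - γ j)).im) {z : ℂ}
    (hz : 0 < z.im) :
    ∑ j, (z - β j).arg - ∑ j, (z - γ j).arg ∈ Set.Icc 0 Real.pi := by
  set θ : ℂ → ℝ := fun z => ∑ j, (z - β j).arg - ∑ j, (z - γ j).arg with hθ
  have hpi := Real.pi_pos
  have hcont : ContinuousOn θ {z : ℂ | 0 < z.im} := by
    have key : ∀ a : ℝ, ContinuousOn (fun z : ℂ => (z - a).arg) {z : ℂ | 0 < z.im} := by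
      intro a w hw
      refine ContinuousAt.continuousWithinAt ?_
      have : ContinuousAt Complex.arg (w - a) := Complex.continuousAt_arg
        (by rw [Complex.mem_slitPlane_iff]; right; simpa using (ne_of_gt hw))
      exact ContinuousAt.comp' this (by fun_prop)
    exact (continuousOn_finsetSum _ fun j _ => key _).sub
      (continuousOn_finsetSum _ fun j _ => key _)
  have hsin : ∀ w : ℂ, 0 < w.im → 0 ≤ Real.sin (θ w) := by
    intro w hw
    have hne : ∀ a : ℝ, 0 < ‖w - a‖ := by
      intro a
      rw [norm_pos_iff]
      intro h0
      have := congrArg Complex.im h0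
      simp at this
      exact hw.ne' this
    have h1 := h w hw
    rw [Complex.prod_eq_prod_norm_mul_exp_sum_arg, Complex.prod_eq_prod_norm_mul_exp_sum_arg,
      mul_div_mul_comm, ← Complex.exp_sub, ← sub_mul, ← Complex.ofReal_sub, ← Complex.ofReal_div,
      Complex.im_ofReal_mul, Complex.exp_ofReal_mul_I_im] at h1
    exact nonneg_of_mul_nonneg_right h1
      (div_pos (Finset.prod_pos fun j _ => hne _) (Finset.prod_pos fun j _ => hne _))
  -- High on the imaginary axis every argument tends to `π / 2`, and both products have `n` factors,
  -- so `θ` tends to `0`.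
  obtain ⟨z₀, hz₀, hθ₀⟩ : ∃ z₀ : ℂ, 0 < z₀.im ∧ |θ z₀| < Real.pi := by
    have hlim : Filter.Tendsto (fun y : ℝ => θ ((y : ℂ) * Complex.I)) Filter.atTop (nhds 0) := by
      have := (tendsto_finsetSum (Finset.univ : Finset (Fin n)) fun j _ =>
        Complex.tendsto_arg_mul_I_sub_atTop (β j)).sub
        (tendsto_finsetSum (Finset.univ : Finset (Fin n)) fun j _ =>
        Complex.tendsto_arg_mul_I_sub_atTop (γ j))
      simpa using this
    have h1 := hlim.abs
    rw [abs_zero] at h1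
    obtain ⟨y, hy, hy0⟩ := ((h1.eventually_lt_const hpi).and
      (Filter.eventually_gt_atTop 0)).exists
    exact ⟨(y : ℂ) * Complex.I, by simpa using hy0, hy⟩
  -- The values of `θ` form an interval, and `sin θ ≥ 0` excludes `(-π, 0)` and `(π, 2π)`. Starting
  -- from `θ z₀` in `[0, π)`, leaving `[0, π]` would hit one of these gaps; the truncations at
  -- `-π/2` and `3π/2` produce such a value.
  have hpre : IsPreconnected (θ '' {z : ℂ | 0 < z.im}) :=
    ((convex_halfSpace_im_gt 0).isPreconnected).image _ hcont
  have hord := hpre.ordConnected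
  rw [abs_lt] at hθ₀
  have hθ₀' : 0 ≤ θ z₀ := by
    by_contra! hneg
    exact absurd (hsin z₀ hz₀) (not_le.2 (Real.sin_neg_of_neg_of_neg_pi_lt hneg hθ₀.1))
  refine ⟨?_, ?_⟩
  · by_contra! hneg
    have hmem : max (θ z) (-(Real.pi / 2)) ∈ θ '' {z : ℂ | 0 < z.im} :=
      hord.out ⟨z, hz, rfl⟩ ⟨z₀, hz₀, rfl⟩
        ⟨le_max_left _ _, max_le (hneg.le.trans hθ₀') (by linarith)⟩
    obtain ⟨w, hw, hwe⟩ := hmem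
    have := hsin w hw
    rw [hwe] at this
    refine absurd this (not_le.2 (Real.sin_neg_of_neg_of_neg_pi_lt (max_lt hneg (by linarith)) ?_))
    exact lt_of_lt_of_le (by linarith) (le_max_right _ _)
  · by_contra! hgt
    have hmem : min (θ z) (3 * Real.pi / 2) ∈ θ '' {z : ℂ | 0 < z.im} :=
      hord.out ⟨z₀, hz₀, rfl⟩ ⟨z, hz, rfl⟩
        ⟨le_min (hθ₀.2.trans hgt).le (by linarith), min_le_left _ _⟩
    obtain ⟨w, hw, hwe⟩ := hmem
    have h1 := hsin w hw
    rw [hwe] at h1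
    have h2 : 0 < Real.sin (min (θ z) (3 * Real.pi / 2) - Real.pi) :=
      Real.sin_pos_of_pos_of_lt_pi (sub_pos.2 (lt_min hgt (by linarith)))
        (by linarith [min_le_right (θ z) (3 * Real.pi / 2)])
    rw [Real.sin_sub_pi] at h2
    linarith

/-! ### Root counts and interlacing -/

/-- As `z` descends to `x`, the argument of `z - δ` tends to `0` if `δ < x` and to `π` if `δ > x`.
The total argument thus tends to `π` times the difference of the two counts, and it stays in `[0,
π]`. -/
theorem card_filter_lt_le_and_le_succ {n : ℕ} {β γ : Fin n → ℝ}
    (h : ∀ z : ℂ, 0 < z.im → 0 ≤ ((∏ j, (z - β j)) / ∏ j, (z - γ j)).im) {x : ℝ}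
    (hβ : ∀ j, β j ≠ x) (hγ : ∀ j, γ j ≠ x) :
    (Finset.univ.filter fun j => x < γ j).card ≤ (Finset.univ.filter fun j => x < β j).card ∧
    (Finset.univ.filter fun j => x < β j).card ≤
      (Finset.univ.filter fun j => x < γ j).card + 1 := by
  have key : ∀ δ : Fin n → ℝ, (∀ j, δ j ≠ x) → Filter.Tendsto
      (fun y : ℝ => ∑ j, ((x : ℂ) + y * Complex.I - δ j).arg) (nhdsWithin 0 (Set.Ioi 0))
      (nhds ((Finset.univ.filter fun j => x < δ j).card * Real.pi)) := by
    intro δ hδ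
    have hs : ((Finset.univ.filter fun j => x < δ j).card : ℝ) * Real.pi =
        ∑ j, if 0 < x - δ j then 0 else Real.pi := by
      rw [← nsmul_eq_mul, ← Finset.sum_const, Finset.sum_filter]
      refine Finset.sum_congr rfl fun j _ => ?_
      rcases lt_or_gt_of_ne (hδ j) with h | h
      · rw [if_neg (not_lt.2 h.le), if_pos (sub_pos.2 h)]
      · rw [if_pos h, if_neg (by linarith)]
    rw [hs]
    refine tendsto_finsetSum _ fun j _ => ?_
    refine (Complex.tendsto_arg_add_mul_I_nhdsGT (sub_ne_zero.2 (hδ j).symm)).congr fun y => ?_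
    push_cast
    congr 1
    ring
  have hlim := (key β hβ).sub (key γ hγ)
  have hmem := isClosed_Icc.mem_of_tendsto hlim (b := nhdsWithin (0 : ℝ) (Set.Ioi 0)) (by
    filter_upwards [self_mem_nhdsWithin] with y hy
    exact sum_arg_sub_sum_arg_mem_Icc h (by simpa using hy))
  rw [← sub_mul] at hmem
  have hpi := Real.pi_pos
  have h1 := nonneg_of_mul_nonneg_left hmem.1 hpi
  have h2 := le_of_mul_le_mul_right (hmem.2.trans_eq (one_mul _).symm) hpi
  constructor
  · exact_mod_cast sub_nonneg.1 h1
  · have : ((Finset.univ.filter fun j => x < β j).card : ℝ) ≤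
      (Finset.univ.filter fun j => x < γ j).card + 1 := by linarith
    exact_mod_cast this

theorem exists_between_forall_ne {n : ℕ} (β γ : Fin n → ℝ) {a b : ℝ} (hab : a < b) :
    ∃ x, a < x ∧ x < b ∧ (∀ j, β j ≠ x) ∧ ∀ j, γ j ≠ x := by
  obtain ⟨x, hx, hx'⟩ := ((Set.Ioo_infinite hab).sdiff
    ((Set.finite_range β).union (Set.finite_range γ))).nonempty
  refine ⟨x, hx.1, hx.2, fun j hj => hx' (Or.inl ⟨j, hj⟩), fun j hj => hx' (Or.inr ⟨j, hj⟩)⟩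

theorem le_card_filter_of_monotone {n : ℕ} {δ : Fin n → ℝ} (hδ : Monotone δ) {x : ℝ} {j : Fin n}
    (hj : x < δ j) : n - j ≤ (Finset.univ.filter fun i => x < δ i).card := by
  rw [← Fin.card_Ici]
  refine Finset.card_le_card fun i hi => ?_
  simpa using hj.trans_le (hδ (Finset.mem_Ici.1 hi))

theorem card_filter_le_of_monotone {n : ℕ} {δ : Fin n → ℝ} (hδ : Monotone δ) {x : ℝ} {j : Fin n}
    (hj : δ j < x) : (Finset.univ.filter fun i => x < δ i).card ≤ n - 1 - j := by
  rw [← Fin.card_Ioi]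
  refine Finset.card_le_card fun i hi => ?_
  rw [Finset.mem_Ioi]
  by_contra! hij
  have := hδ hij
  have := (Finset.mem_filter.1 hi).2
  linarith

/-- Interlacing from the mapping property of the quotient on the upper half plane. -/
theorem le_and_le_succ_of_im_div_nonneg {d : ℕ} {β γ : Fin (d + 1) → ℝ} (hβ : Monotone β)
    (hγ : Monotone γ)
    (h : ∀ z : ℂ, 0 < z.im → 0 ≤ ((∏ j, (z - β j)) / ∏ j, (z - γ j)).im) :
    (∀ j, γ j ≤ β j) ∧ ∀ j : Fin d, β j.castSucc ≤ γ j.succ := by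
  constructor
  · intro j
    by_contra! hj
    obtain ⟨x, hx1, hx2, hx3, hx4⟩ := exists_between_forall_ne β γ hj
    have h1 := (card_filter_lt_le_and_le_succ h hx3 hx4).1
    have h2 := le_card_filter_of_monotone hγ hx2
    have h3 := card_filter_le_of_monotone hβ hx1
    have := j.2
    omega
  · intro j
    by_contra! hj
    obtain ⟨x, hx1, hx2, hx3, hx4⟩ := exists_between_forall_ne β γ hj
    have h1 := (card_filter_lt_le_and_le_succ h hx3 hx4).2
    have h2 := le_card_filter_of_monotone hβ hx2
    have h3 := card_filter_le_of_monotone hγ hx1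
    have := j.2
    simp only [Fin.val_castSucc, Fin.val_succ] at h2 h3
    omega

/-! ### Stability of bi-affine polynomials -/

/-- The operator `1 - ∂ₛ ∂ₜ` preserves stability of bi-affine polynomials. -/
theorem sub_add_ne_zero_of_stable {a b c d : ℂ}
    (h : ∀ s t : ℂ, 0 < s.im → 0 < t.im → a + b * s + c * t + d * s * t ≠ 0) {s t : ℂ}
    (hs : 0 < s.im) (ht : 0 < t.im) : a - d + b * s + c * t + d * s * t ≠ 0 := by
  by_cases hd : d = 0
  · simpa [hd] using h s t hs ht
  have hb : 0 ≤ (b / d).im := by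
    by_contra! hb
    -- At `t = t₀ + τ` the polynomial equals `d (τ (s + c/d) + κ)`. It vanishes for `s = iR - c/d`,
    -- `τ = iκ/R`, and `R` is large enough to put both `s` and `t` in the upper half plane.
    set t₀ := -(b / d) with ht₀
    have hT : 0 < t₀.im := by simpa [ht₀] using hb
    set κ := (a + c * t₀) / d with hκ
    set R : ℝ := |(c / d).im| + |κ.re| / t₀.im + 1 with hR
    have hq : 0 ≤ |κ.re| / t₀.im := by positivity
    have hR0 : 0 < R := by positivity
    have hRc : (R : ℂ) ≠ 0 := by exact_mod_cast hR0.ne'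
    have h1 : 0 < (Complex.I * R - c / d).im := by
      have := le_abs_self (c / d).im
      simp only [Complex.sub_im, Complex.mul_im, Complex.I_re, Complex.I_im, Complex.ofReal_re,
        Complex.ofReal_im]
      linarith
    have h2 : 0 < (t₀ + Complex.I * κ / R).im := by
      rw [Complex.add_im, Complex.div_ofReal_im]
      have h3 : |κ.re| / t₀.im < R := by have := abs_nonneg (c / d).im; linarith
      rw [div_lt_iff₀ hT] at h3
      have h4 : (Complex.I * κ).im = κ.re := by simp
      rw [h4]
      have h5 : -t₀.im < κ.re / R := by
        rw [lt_div_iff₀ hR0]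
        have := neg_abs_le κ.re
        linarith
      linarith
    refine h _ _ h1 h2 ?_
    have h6 : a = d * κ - c * t₀ := by rw [hκ]; field_simp; ring
    have h7 : b = -(d * t₀) := by rw [ht₀]; field_simp
    rw [h6, h7]
    field_simp
    ring_nf
    simp [Complex.I_sq]
  intro h0
  have hD : 0 < (t + b / d).im := by rw [Complex.add_im]; linarith
  have hDne : t + b / d ≠ 0 := fun h => by simp [h] at hD
  -- Subtracting `d` amounts to replacing `s` by `s - 1/(t + b/d)`, which increases `Im s`.
  refine h (s - 1 / (t + b / d)) t ?_ ht ?_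
  · have : (1 / (t + b / d)).im < 0 := by
      rw [one_div, Complex.inv_im]
      exact div_neg_of_neg_of_pos (by linarith) (Complex.normSq_pos.2 hDne)
    rw [Complex.sub_im]
    linarith
  · have h8 : d * (t + b / d) = d * t + b := by field_simp
    have h9 : (d * t + b) * (1 / (t + b / d)) = d := by
      rw [← h8, mul_assoc, mul_one_div_cancel hDne, mul_one]
    linear_combination h0 - h9

/-! ### Signed sums -/

/-- The sum of `g (N ± A₁ ± ⋯ ± Aᵣ)` over all choices of signs, for a list `[A₁, …, Aᵣ]`. -/
def signedSum {A M : Type*} [AddGroup A] [AddCommMonoid M] (g : A → M) : List A → A → M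
  | [], N => g N
  | K :: l, N => signedSum g l (N + K) + signedSum g l (N - K)

theorem map_signedSum {A M M' F : Type*} [AddGroup A] [AddCommMonoid M] [AddCommMonoid M']
    [FunLike F M M'] [AddMonoidHomClass F M M'] (φ : F) (g : A → M) (l : List A) (N : A) :
    φ (signedSum g l N) = signedSum (fun N => φ (g N)) l N := by
  induction l generalizing N with
  | nil => rfl
  | cons K l ih => simp only [signedSum, map_add, ih]

theorem signedSum_induction {A M : Type*} [AddGroup A] [AddCommMonoid M] {g : A → M}
    (Q : A → Prop) (P : M → Prop) (hP : ∀ x y, P x → P y → P (x + y)) (hg : ∀ N, Q N → P (g N))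
    {l : List A} (hl : ∀ K ∈ l, ∀ N, Q N → Q (N + K) ∧ Q (N - K)) {N : A} (hN : Q N) :
    P (signedSum g l N) := by
  induction l generalizing N with
  | nil => exact hg N hN
  | cons K l ih =>
    have h := hl K (by simp) N hN
    have hl' : ∀ K ∈ l, ∀ N, Q N → Q (N + K) ∧ Q (N - K) := fun K hK => hl K (by simp [hK])
    exact hP _ _ (ih hl' h.1) (ih hl' h.2)

/-! ### Dissipative matrices -/

section Dissipative

variable {V : Type*} [Fintype V]

/-- A matrix `N` such that the imaginary part `(N - Nᴴ) / 2i` is negative semidefinite. -/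
def IsDissipative (N : Matrix V V ℂ) : Prop := ∀ x : V → ℂ, (star x ⬝ᵥ N.mulVec x).im ≤ 0

theorem Matrix.IsHermitian.isDissipative {N : Matrix V V ℂ} (hN : N.IsHermitian) :
    IsDissipative N := fun x => (hN.im_star_dotProduct_mulVec_self x).le

/-- The form of `w wᴴ` at `x` is `|wᴴ x|²`, so only the sign of `Im r` matters. Non-real `r` is what
later controls `Im (f / q)`. -/
theorem Matrix.IsHermitian.isDissipative_add_smul_vecMulVec {N : Matrix V V ℂ}
    (hN : N.IsHermitian) (w : V → ℂ) {r : ℂ} (hr : r.im ≤ 0) :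
    IsDissipative (N + r • Matrix.vecMulVec w (star w)) := by
  intro x
  have h : star x ⬝ᵥ (Matrix.vecMulVec w (star w)).mulVec x =
      (Complex.normSq (star w ⬝ᵥ x) : ℂ) := by
    rw [Matrix.vecMulVec_mulVec, Complex.normSq_eq_conj_mul_self, starRingEnd_apply,
      ← Matrix.star_dotProduct_star]
    simp [mul_comm]
  rw [Matrix.add_mulVec, dotProduct_add, Matrix.smul_mulVec, dotProduct_smul, h, Complex.add_im,
    smul_eq_mul, Complex.im_mul_ofReal]
  have h1 := hN.isDissipative x
  have h2 := mul_nonpos_of_nonpos_of_nonneg hr (Complex.normSq_nonneg (star w ⬝ᵥ x))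
  linarith

end Dissipative

/-! ### Stability of signed sums of determinants -/

section Stability

variable {V : Type*} [DecidableEq V]

/-- The Hermitian matrix with entry `i` at `(u, v)`, `-i` at `(v, u)` and `0` elsewhere. -/
noncomputable def edgeMatrix (u v : V) : Matrix V V ℂ :=
  Complex.I • (Matrix.single u v 1 - Matrix.single v u 1)

theorem isHermitian_edgeMatrix (u v : V) : (edgeMatrix u v).IsHermitian := by
  simp [Matrix.IsHermitian, edgeMatrix, Matrix.conjTranspose_smul, Matrix.conjTranspose_sub,
    ← smul_neg]

/-- On every two-dimensional slice in the directions `u`, `v`, the function `F` is bi-affine and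
`G = 2 (1 - ∂ᵤ ∂ᵥ) F`. -/
def IsMixedDifference (u v : V) (F G : (V → ℂ) → ℂ) : Prop :=
  ∀ z, ∃ a b c d : ℂ, ∀ s t,
    F (Function.update (Function.update z u s) v t) = a + b * s + c * t + d * s * t ∧
    G (Function.update (Function.update z u s) v t) = 2 * (a - d + b * s + c * t + d * s * t)

theorem IsMixedDifference.add {u v : V} {F G F' G' : (V → ℂ) → ℂ} (h : IsMixedDifference u v F G)
    (h' : IsMixedDifference u v F' G') :
    IsMixedDifference u v (fun z => F z + F' z) (fun z => G z + G' z) := by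
  intro z
  obtain ⟨a, b, c, d, h⟩ := h z
  obtain ⟨a', b', c', d', h'⟩ := h' z
  refine ⟨a + a', b + b', c + c', d + d', fun s t => ⟨?_, ?_⟩⟩
  · simp only [(h s t).1, (h' s t).1]; ring
  · simp only [(h s t).2, (h' s t).2]; ring

theorem IsMixedDifference.ne_zero {u v : V} {F G : (V → ℂ) → ℂ} (h : IsMixedDifference u v F G)
    (hF : ∀ z : V → ℂ, (∀ w, 0 < (z w).im) → F z ≠ 0) {z : V → ℂ} (hz : ∀ w, 0 < (z w).im) :
    G z ≠ 0 := by
  obtain ⟨a, b, c, d, h⟩ := h z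
  have hz' : z = Function.update (Function.update z u (z u)) v (z v) := by simp
  rw [hz', (h _ _).2]
  refine mul_ne_zero two_ne_zero (sub_add_ne_zero_of_stable (fun s t hs ht => ?_) (hz u) (hz v))
  rw [← (h s t).1]
  refine hF _ fun w => ?_
  by_cases hv : w = v
  · subst hv; simpa using ht
  · by_cases hu : w = u
    · subst hu; simpa [hv] using hs
    · simpa [hv, hu] using hz w

variable [Fintype V]

/-- The determinant is bilinear and alternating in rows `u` and `v`, where `± E_uv` adds multiples
of `e_v` and `e_u`. Terms linear in the sign cancel; the quadratic one is `i² = -1` times the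
coefficient of `s t`. -/
theorem isMixedDifference_det {u v : V} (huv : u ≠ v) (N : Matrix V V ℂ) :
    IsMixedDifference u v (fun z => (Matrix.diagonal z - N).det)
      (fun z => (Matrix.diagonal z - (N + edgeMatrix u v)).det +
        (Matrix.diagonal z - (N - edgeMatrix u v)).det) := by
  intro z
  set M := Matrix.diagonal (Function.update (Function.update z u 0) v 0) - N with hM
  set D : (V → ℂ) → (V → ℂ) → ℂ := fun x y => ((M.updateRow u x).updateRow v y).det with hD
  have comm : ∀ x y, (M.updateRow u x).updateRow v y = (M.updateRow v y).updateRow u x :=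
    fun x y => Matrix.updateRow_comm _ huv _ _
  have add_left : ∀ x x' y, D (x + x') y = D x y + D x' y := fun x x' y => by
    simp only [hD, comm, Matrix.det_updateRow_add]
  have smul_left : ∀ (r : ℂ) x y, D (r • x) y = r * D x y := fun r x y => by
    simp only [hD, comm, Matrix.det_updateRow_smul]
  have add_right : ∀ x y y', D x (y + y') = D x y + D x y' := fun x y y' => by
    simp only [hD, Matrix.det_updateRow_add]
  have smul_right : ∀ (r : ℂ) x y, D x (r • y) = r * D x y := fun r x y => by
    simp only [hD, Matrix.det_updateRow_smul]
  have alt : ∀ x, D x x = 0 := fun x =>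
    Matrix.det_zero_of_row_eq huv (by simp [Matrix.updateRow_ne huv])
  have swap : ∀ x y, D y x = -D x y := fun x y => by
    have h := alt (x + y)
    simp only [add_left, add_right, alt] at h
    linear_combination h
  have key : ∀ (ε s t : ℂ), (Matrix.diagonal (Function.update (Function.update z u s) v t) -
      (N + ε • edgeMatrix u v)).det =
      D (M u + s • Pi.single u 1 + (-(ε * Complex.I)) • Pi.single v 1)
        (M v + t • Pi.single v 1 + (ε * Complex.I) • Pi.single u 1) := by
    intro ε s t
    simp only [hD]
    congr 1
    ext x y
    by_cases hxv : x = v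
    · subst hxv
      by_cases hyv : y = x
      · subst hyv; simp [hM, edgeMatrix, huv, huv.symm]; ring
      · by_cases hyu : y = u
        · subst hyu
          simp [hM, edgeMatrix, huv, huv.symm]; ring
        · simp [hM, edgeMatrix, huv, hyv, hyu,
            Ne.symm hyv, Ne.symm hyu]
    · by_cases hxu : x = u
      · subst hxu
        by_cases hyv : y = v
        · subst hyv
          simp [hM, edgeMatrix, huv, huv.symm]; ring
        · by_cases hyu : y = x
          · subst hyu; simp [hM, edgeMatrix, huv, huv.symm]; ring
          · simp [hM, edgeMatrix, huv, hyv, hyu,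
              Ne.symm hyv, Ne.symm hyu]
      · simp [hM, edgeMatrix, Matrix.diagonal_apply, hxv, hxu, Ne.symm hxv,
          Ne.symm hxu, Matrix.updateRow_ne]
  refine ⟨D (M u) (M v), D (Pi.single u 1) (M v), D (M u) (Pi.single v 1),
    D (Pi.single u 1) (Pi.single v 1), fun s t => ?_⟩
  have h0 := key 0 s t
  have h1 := key 1 s t
  have h2 := key (-1) s t
  simp only [zero_smul, one_smul, neg_smul, add_zero, ← sub_eq_add_neg] at h0 h1 h2
  have hs := swap (Pi.single u 1) (Pi.single v 1)
  simp only [h0, h1, h2]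
  simp only [sub_eq_add_neg, ← neg_smul, add_left, add_right, smul_left, smul_right, alt, hs]
  constructor
  · ring
  · ring_nf
    rw [Complex.I_sq]
    ring

theorem isMixedDifference_signedSum_det {u v : V} (huv : u ≠ v) (l : List (Matrix V V ℂ))
    (N : Matrix V V ℂ) :
    IsMixedDifference u v (fun z => signedSum (fun N => (Matrix.diagonal z - N).det) l N)
      (fun z => signedSum (fun N => (Matrix.diagonal z - N).det) l (N + edgeMatrix u v) +
        signedSum (fun N => (Matrix.diagonal z - N).det) l (N - edgeMatrix u v)) := by
  induction l generalizing N with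
  | nil => exact isMixedDifference_det huv N
  | cons K l ih =>
    have h := (ih (N + K)).add (ih (N - K))
    have e₁ : N + edgeMatrix u v + K = N + K + edgeMatrix u v := by abel
    have e₂ : N + edgeMatrix u v - K = N - K + edgeMatrix u v := by abel
    have e₃ : N - edgeMatrix u v + K = N + K - edgeMatrix u v := by abel
    have e₄ : N - edgeMatrix u v - K = N - K - edgeMatrix u v := by abel
    simp only [signedSum, e₁, e₂, e₃, e₄]
    simp only [add_add_add_comm] at h ⊢
    exact h

theorem im_star_dotProduct_diagonal_pos {z x : V → ℂ} (hz : ∀ v, 0 < (z v).im) (hx : x ≠ 0) :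
    0 < (star x ⬝ᵥ (Matrix.diagonal z).mulVec x).im := by
  have h : (star x ⬝ᵥ (Matrix.diagonal z).mulVec x).im =
      ∑ v, (z v).im * Complex.normSq (x v) := by
    simp only [dotProduct, Matrix.mulVec_diagonal, Complex.im_sum]
    refine Finset.sum_congr rfl fun v _ => ?_
    rw [mul_left_comm, Pi.star_apply, ← starRingEnd_apply, ← Complex.normSq_eq_conj_mul_self]
    simp
  rw [h]
  obtain ⟨v, hv⟩ := Function.ne_iff.1 hx
  exact Finset.sum_pos' (fun w _ => mul_nonneg (hz w).le (Complex.normSq_nonneg _))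
    ⟨v, Finset.mem_univ _, mul_pos (hz v) (Complex.normSq_pos.2 hv)⟩

/-- A kernel vector `x` would give `xᴴ diag(z) x = xᴴ N x`, with positive imaginary part on the left
and nonpositive on the right. -/
theorem IsDissipative.det_diagonal_sub_ne_zero {N : Matrix V V ℂ} (hN : IsDissipative N)
    {z : V → ℂ} (hz : ∀ v, 0 < (z v).im) : (Matrix.diagonal z - N).det ≠ 0 := by
  intro h
  obtain ⟨x, hx, hx0⟩ := Matrix.exists_mulVec_eq_zero_iff.2 h
  rw [Matrix.sub_mulVec, sub_eq_zero] at hx0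
  have h1 := im_star_dotProduct_diagonal_pos hz hx
  rw [hx0] at h1
  exact absurd (hN x) (not_le.2 h1)

/-- The two signs of one edge combine into `2 (1 - ∂ᵤ∂ᵥ)` of the signed sum over the other edges at
the same `N`, so the induction never moves `N`. -/
theorem IsDissipative.signedSum_det_ne_zero {N : Matrix V V ℂ} (hN : IsDissipative N)
    {l : List (V × V)} (hl : ∀ p ∈ l, p.1 ≠ p.2) {z : V → ℂ} (hz : ∀ v, 0 < (z v).im) :
    signedSum (fun N => (Matrix.diagonal z - N).det) (l.map fun p => edgeMatrix p.1 p.2) N ≠ 0 := by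
  induction l generalizing z with
  | nil => exact hN.det_diagonal_sub_ne_zero hz
  | cons p l ih =>
    exact (isMixedDifference_signedSum_det (hl p (by simp)) _ N).ne_zero
      (fun z hz => ih (fun p hp => hl p (by simp [hp])) hz) hz

/-- By the matrix determinant lemma a single determinant is affine in `r`; this passes to sums. -/
theorem signedSum_det_add_smul_vecMulVec {N : Matrix V V ℂ} (hN : N.IsHermitian) (w : V → ℂ) (r : ℂ)
    {l : List (Matrix V V ℂ)} (hl : ∀ K ∈ l, K.IsHermitian) {z : V → ℂ} (hz : ∀ v, 0 < (z v).im) :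
    signedSum (fun N => (Matrix.diagonal z - N).det) l (N + r • Matrix.vecMulVec w (star w)) =
      (1 - r) * signedSum (fun N => (Matrix.diagonal z - N).det) l N +
      r * signedSum (fun N => (Matrix.diagonal z - N).det) l (N + Matrix.vecMulVec w (star w)) := by
  induction l generalizing N with
  | nil =>
    have hA := (hN.isDissipative.det_diagonal_sub_ne_zero hz).isUnit
    have key : ∀ r : ℂ, (Matrix.diagonal z - (N + r • Matrix.vecMulVec w (star w))).det =
        (Matrix.diagonal z - N).det *
          (1 - r * (star w ⬝ᵥ (Matrix.diagonal z - N)⁻¹.mulVec w)) := by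
      intro r
      have h := Matrix.det_add_replicateCol_mul_replicateRow (ι := Unit) hA ((-r) • w) (star w)
      rw [← Matrix.vecMulVec_eq Unit, Matrix.smul_vecMulVec] at h
      rw [← sub_sub, sub_eq_add_neg _ (r • _), ← neg_smul, h]
      congr 1
      rw [Matrix.mul_assoc, Matrix.replicateCol_smul, Matrix.mul_smul, Matrix.mul_smul,
        ← Matrix.replicateCol_mulVec, Matrix.det_unique, Matrix.add_apply, Matrix.smul_apply,
        Matrix.one_apply_eq, Matrix.replicateRow_mul_replicateCol_apply, smul_eq_mul, neg_mul,
        ← sub_eq_add_neg]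
    have h1 := key 1
    rw [one_smul] at h1
    simp only [signedSum, key, h1]
    ring
  | cons K l ih =>
    have hK := hl K (by simp)
    have hl' : ∀ K ∈ l, K.IsHermitian := fun K hK => hl K (by simp [hK])
    simp only [signedSum]
    rw [add_right_comm N _ K, add_right_comm N _ K, add_sub_right_comm N _ K,
      add_sub_right_comm N _ K, ih (hN.add hK) hl', ih (hN.sub hK) hl']
    ring

end Stability

/-! ### Ordered real roots -/

theorem Polynomial.exists_monotone_roots {p : ℂ[X]} {n : ℕ} (hn : p.natDegree = n)
    (hp : ∀ z : ℂ, p.IsRoot z → z.im = 0) :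
    ∃ β : Fin n → ℝ, Monotone β ∧ p = C p.leadingCoeff * ∏ j, (X - C (β j : ℂ)) := by
  by_cases hp0 : p = 0
  · subst hp0
    exact ⟨fun _ => 0, monotone_const, by simp⟩
  have hsplit := IsAlgClosed.splits p
  have hcard : (p.roots.map Complex.re).toList.length = n := by
    rw [Multiset.length_toList, Multiset.card_map, ← hn, hsplit.natDegree_eq_card_roots]
  set δ : Fin n → ℝ := fun j => (p.roots.map Complex.re).toList.get (j.cast hcard.symm) with hδ
  refine ⟨δ ∘ Tuple.sort δ, Tuple.monotone_sort δ, ?_⟩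
  have h1 : Multiset.map δ Finset.univ.val = p.roots.map Complex.re := by
    rw [Fin.univ_val_map]
    conv_rhs => rw [← Multiset.coe_toList (p.roots.map Complex.re)]
    congr 1
    apply List.ext_get
    · simp [hcard]
    · intro i h h'
      simp [hδ]
  have h2 : p.roots = (p.roots.map Complex.re).map Complex.ofReal := by
    rw [Multiset.map_map]
    conv_lhs => rw [← Multiset.map_id p.roots]
    refine Multiset.map_congr rfl fun z hz => ?_
    have := hp z (isRoot_of_mem_roots hz)
    exact Complex.ext rfl (by simpa using this)
  have h3 : ∏ j, (X - C (((δ ∘ Tuple.sort δ) j : ℝ) : ℂ)) = ∏ j, (X - C (δ j : ℂ)) :=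
    Equiv.prod_comp (Tuple.sort δ) fun j => X - C (δ j : ℂ)
  rw [h3, Finset.prod_eq_multiset_prod]
  conv_lhs => rw [hsplit.eq_prod_roots, h2, ← h1]
  simp only [Multiset.map_map, Function.comp_def]

/-! ### Real-rootedness and common interlacing of signed sums -/

section CommonInterlacing

/-- Since `|ε i| = 1`, the diagonal of `w wᴴ` is the same for both signs; only the off-diagonal part
`ε E_uv` varies. The base matrix is therefore independent of `ε`. -/
theorem add_smul_edgeMatrix_eq {V : Type*} [DecidableEq V] (N : Matrix V V ℂ) {u v : V} (huv : u ≠ v) {ε : ℤ}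
    (hε : ε = -1 ∨ ε = 1) :
    N + ε • edgeMatrix u v = (N - (Matrix.single u u 1 + Matrix.single v v 1)) +
      Matrix.vecMulVec (Pi.single u 1 - Pi.single v (ε * Complex.I))
        (star (Pi.single u 1 - Pi.single v (ε * Complex.I))) := by
  have key : ε • edgeMatrix u v + (Matrix.single u u 1 + Matrix.single v v 1) =
      Matrix.vecMulVec (Pi.single u 1 - Pi.single v (ε * Complex.I))
        (star (Pi.single u 1 - Pi.single v (ε * Complex.I))) := by
    ext x y
    by_cases hxu : x = u <;> by_cases hxv : x = v <;> by_cases hyu : y = u <;>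
      by_cases hyv : y = v <;> rcases hε with rfl | rfl <;>
      simp_all [edgeMatrix, Matrix.single_apply, Matrix.vecMulVec_apply, Ne.symm, eq_comm]
  rw [← key]
  abel

variable {V : Type*} [Fintype V] [DecidableEq V]

theorem Matrix.IsHermitian.eval_charpoly_conj {N : Matrix V V ℂ} (hN : N.IsHermitian) (z : ℂ) :
    N.charpoly.eval (star z) = star (N.charpoly.eval z) := by
  rw [hN.charpoly_eq]
  simp [eval_prod, star_prod]

theorem Matrix.IsHermitian.realRooted_charpoly {N : Matrix V V ℂ} (hN : N.IsHermitian) :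
    RealRooted N.charpoly := by
  have h : N.charpoly = (∏ i, (X - C (hN.eigenvalues i))).map Complex.ofRealHom := by
    rw [hN.charpoly_eq, Polynomial.map_prod]
    simp
  constructor
  · intro k
    rw [h, coeff_map]
    exact Complex.ofReal_im _
  · intro z hz
    rw [hN.charpoly_eq, IsRoot.def, eval_prod, Finset.prod_eq_zero_iff] at hz
    obtain ⟨i, -, hi⟩ := hz
    have : z = (hN.eigenvalues i : ℂ) := by simpa [sub_eq_zero] using hi
    rw [this, Complex.ofReal_im]

theorem natDegree_le_and_coeff_signedSum_charpoly (l : List (Matrix V V ℂ)) (N : Matrix V V ℂ) :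
    (signedSum Matrix.charpoly l N).natDegree ≤ Fintype.card V ∧
      (signedSum Matrix.charpoly l N).coeff (Fintype.card V) = 2 ^ l.length := by
  induction l generalizing N with
  | nil =>
    refine ⟨N.charpoly_natDegree_eq_dim.le, ?_⟩
    have h := N.charpoly_monic.coeff_natDegree
    rw [N.charpoly_natDegree_eq_dim] at h
    simpa [signedSum] using h
  | cons K l ih =>
    refine ⟨natDegree_add_le_of_degree_le (ih _).1 (ih _).1, ?_⟩
    rw [signedSum, coeff_add, (ih _).2, (ih _).2, List.length_cons, pow_succ]
    ring

theorem natDegree_signedSum_charpoly (l : List (Matrix V V ℂ)) (N : Matrix V V ℂ) :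
    (signedSum Matrix.charpoly l N).natDegree = Fintype.card V := by
  have h := natDegree_le_and_coeff_signedSum_charpoly l N
  exact natDegree_eq_of_le_of_coeff_ne_zero h.1 (by rw [h.2]; exact pow_ne_zero _ two_ne_zero)

theorem leadingCoeff_signedSum_charpoly (l : List (Matrix V V ℂ)) (N : Matrix V V ℂ) :
    (signedSum Matrix.charpoly l N).leadingCoeff = 2 ^ l.length := by
  rw [leadingCoeff, natDegree_signedSum_charpoly, (natDegree_le_and_coeff_signedSum_charpoly l N).2]

theorem eval_signedSum_charpoly (l : List (Matrix V V ℂ)) (N : Matrix V V ℂ) (z : ℂ) :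
    (signedSum Matrix.charpoly l N).eval z =
      signedSum (fun N => (Matrix.diagonal (fun _ => z) - N).det) l N := by
  have h := map_signedSum (Polynomial.evalRingHom z) Matrix.charpoly l N
  simpa [Matrix.eval_charpoly] using h

/-- Stability excludes roots in the upper half plane, and conjugation symmetry carries this to the
lower one. -/
theorem im_eq_zero_of_isRoot_signedSum_charpoly {N : Matrix V V ℂ} (hN : N.IsHermitian)
    {l : List (V × V)} (hl : ∀ p ∈ l, p.1 ≠ p.2) {z : ℂ}
    (hz : (signedSum Matrix.charpoly (l.map fun p => edgeMatrix p.1 p.2) N).IsRoot z) :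
    z.im = 0 := by
  have key : ∀ w : ℂ, 0 < w.im →
      (signedSum Matrix.charpoly (l.map fun p => edgeMatrix p.1 p.2) N).eval w ≠ 0 := by
    intro w hw
    rw [eval_signedSum_charpoly]
    exact hN.isDissipative.signedSum_det_ne_zero hl fun _ => hw
  have hconj : ∀ w : ℂ, (signedSum Matrix.charpoly (l.map fun p => edgeMatrix p.1 p.2) N).eval
      (star w) = star ((signedSum Matrix.charpoly (l.map fun p => edgeMatrix p.1 p.2) N).eval w) :=
    fun w => signedSum_induction Matrix.IsHermitian
      (fun p : ℂ[X] => p.eval (star w) = star (p.eval w))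
      (fun p q hp hq => by rw [eval_add, hp, hq, eval_add, star_add])
      (fun N hN => hN.eval_charpoly_conj w)
      (fun K hK N hN => by
        obtain ⟨p, -, rfl⟩ := List.mem_map.1 hK
        exact ⟨hN.add (isHermitian_edgeMatrix _ _), hN.sub (isHermitian_edgeMatrix _ _)⟩) hN
  rcases lt_trichotomy z.im 0 with h | h | h
  · exact absurd (by rw [hconj, hz.eq_zero, star_zero]) (key (star z) (by simpa using h))
  · exact h
  · exact absurd hz.eq_zero (key z h)

/-- A rank-one positive semidefinite perturbation `N + w wᴴ` changes the signed sum of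
characteristic polynomials by a factor that maps the upper half plane to its closure. -/
theorem im_eval_signedSum_charpoly_add_vecMulVec_div_nonneg {N : Matrix V V ℂ} (hN : N.IsHermitian)
    (w : V → ℂ) {l : List (V × V)} (hl : ∀ p ∈ l, p.1 ≠ p.2) {z : ℂ} (hz : 0 < z.im) :
    0 ≤ ((signedSum Matrix.charpoly (l.map fun p => edgeMatrix p.1 p.2)
        (N + Matrix.vecMulVec w (star w))).eval z /
      (signedSum Matrix.charpoly (l.map fun p => edgeMatrix p.1 p.2) N).eval z).im := by
  rw [eval_signedSum_charpoly, eval_signedSum_charpoly]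
  set l' := l.map fun p => edgeMatrix p.1 p.2 with hl'
  have hherm : ∀ K ∈ l', K.IsHermitian := by
    intro K hK
    obtain ⟨p, -, rfl⟩ := List.mem_map.1 hK
    exact isHermitian_edgeMatrix _ _
  have hz' : ∀ v : V, 0 < ((fun _ => z) v).im := fun _ => hz
  have hq := hN.isDissipative.signedSum_det_ne_zero hl hz'
  rw [← hl'] at hq
  set q := signedSum (fun N => (Matrix.diagonal (fun _ => z) - N).det) l' N with hq'
  set f := signedSum (fun N => (Matrix.diagonal (fun _ => z) - N).det) l'
    (N + Matrix.vecMulVec w (star w)) with hf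
  -- The value `(1 - r) q + r f = q (1 - r (1 - f/q))` vanishes at `r = (1 - f/q)⁻¹`. If `Im (f/q) <
  -- 0`, this `r` has `Im r ≤ 0`, against stability.
  by_contra! hneg
  have him : 0 < (1 - f / q).im := by simpa using hneg
  have hne : 1 - f / q ≠ 0 := fun h => by simp [h] at him
  have hr : ((1 - f / q)⁻¹).im ≤ 0 := by
    rw [Complex.inv_im]
    exact div_nonpos_of_nonpos_of_nonneg (by linarith) (Complex.normSq_nonneg _)
  refine (hN.isDissipative_add_smul_vecMulVec w hr).signedSum_det_ne_zero hl hz' ?_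
  rw [← hl', signedSum_det_add_smul_vecMulVec hN w _ hherm hz', ← hq', ← hf]
  have h1 : (1 - f / q)⁻¹ * (1 - f / q) = 1 := inv_mul_cancel₀ hne
  have h2 : f = (f / q) * q := by field_simp
  linear_combination (-q) * h1 + (1 - f / q)⁻¹ * h2

theorem hasCommonInterlacing_signedSum_charpoly [Nonempty V] {N : Matrix V V ℂ}
    (hN : N.IsHermitian) {u v : V} (huv : u ≠ v) {l : List (V × V)} (hl : ∀ p ∈ l, p.1 ≠ p.2) :
    HasCommonInterlacing fun ε : Signs => signedSum Matrix.charpoly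
      (l.map fun p => edgeMatrix p.1 p.2) (N + (ε : ℤ) • edgeMatrix u v) := by
  obtain ⟨d, hd⟩ := Nat.exists_eq_succ_of_ne_zero (Fintype.card_ne_zero (α := V))
  have hN' : (N - (Matrix.single u u 1 + Matrix.single v v 1)).IsHermitian :=
    hN.sub (by simp [Matrix.IsHermitian])
  set l' := l.map fun p => edgeMatrix p.1 p.2 with hl'
  obtain ⟨γ, hγ, hq⟩ := Polynomial.exists_monotone_roots
    ((natDegree_signedSum_charpoly l' (N - (Matrix.single u u 1 + Matrix.single v v 1))).trans hd)
    fun z hz => im_eq_zero_of_isRoot_signedSum_charpoly hN' hl hz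
  -- The smallest root `γ 0` is dropped: `γ j ≤ β j ≤ γ (j + 1)` then reads `β j ≤ γ (j + 1) ≤ β (j
  -- + 1)`.
  refine ⟨∏ j : Fin d, (X - C (γ j.succ : ℂ)), fun ε => ?_⟩
  have hε : (ε : ℤ) = -1 ∨ (ε : ℤ) = 1 := by
    obtain ⟨a, ha⟩ := ε
    simpa using ha
  have hNε : (N + (ε : ℤ) • edgeMatrix u v).IsHermitian := by
    rcases hε with h | h <;> rw [h]
    · simpa [← sub_eq_add_neg] using hN.sub (isHermitian_edgeMatrix u v)
    · simpa using hN.add (isHermitian_edgeMatrix u v)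
  obtain ⟨β, hβ, hf⟩ := Polynomial.exists_monotone_roots
    ((natDegree_signedSum_charpoly l' (N + (ε : ℤ) • edgeMatrix u v)).trans hd)
    fun z hz => im_eq_zero_of_isRoot_signedSum_charpoly hNε hl hz
  rw [leadingCoeff_signedSum_charpoly] at hq hf
  have hint := le_and_le_succ_of_im_div_nonneg hβ hγ fun z hz => by
    have h := im_eval_signedSum_charpoly_add_vecMulVec_div_nonneg hN'
      (Pi.single u 1 - Pi.single v ((ε : ℤ) * Complex.I)) hl hz
    rw [← add_smul_edgeMatrix_eq N huv hε, ← hl', hq, hf, eval_mul, eval_mul, eval_C,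
      mul_div_mul_left _ _ (pow_ne_zero _ two_ne_zero)] at h
    simpa [eval_prod] using h
  refine ⟨d, fun j => γ j.succ, β, 2 ^ l'.length, by positivity, rfl, ?_, fun j =>
    ⟨hint.2 j, hint.1 j.succ⟩⟩
  push_cast
  exact hf

end CommonInterlacing

/-! ### Partial sums as signed sums -/

section PartialSum

open Classical in
theorem partialSum_self {m : ℕ} {S : Fin m → Type*} [∀ i, Fintype (S i)]
    (f : (∀ i, S i) → ℂ[X]) (hk : m ≤ m) (s : ∀ i : Fin m, S (Fin.castLE hk i)) :
    partialSum f m hk s = f s := by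
  have : (Finset.univ.filter fun t : ∀ i, S i => ∀ i : Fin m, t (Fin.castLE hk i) = s i) = {s} := by
    ext t
    simp only [Finset.mem_filter, Finset.mem_univ, true_and, Finset.mem_singleton]
    exact ⟨fun h => funext h, fun h i => congrFun h i⟩
  rw [partialSum, this, Finset.sum_singleton]

open Classical in
theorem partialSum_eq_sum_snoc {m : ℕ} {S : Fin m → Type*} [∀ i, Fintype (S i)]
    (f : (∀ i, S i) → ℂ[X]) (k : ℕ) (hk : k < m) (s : ∀ i : Fin k, S (Fin.castLE hk.le i)) :
    partialSum f k hk.le s = ∑ a : S ⟨k, hk⟩, partialSum f (k + 1) hk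
      (Fin.snoc (α := fun i : Fin (k + 1) => S (Fin.castLE hk i)) s a) := by
  rw [partialSum, ← Finset.sum_fiberwise _ fun t => t ⟨k, hk⟩]
  refine Finset.sum_congr rfl fun a _ => ?_
  rw [partialSum, Finset.filter_filter]
  refine Finset.sum_congr (Finset.filter_congr fun t _ => ?_) fun _ _ => rfl
  rw [Fin.forall_fin_succ']
  refine and_congr (forall_congr' fun i => ?_) ?_
  · rw [Fin.snoc_castSucc]; rfl
  · rw [Fin.snoc_last]; rfl

/-- Induction on the number `m - k` of free signs: splitting on the next sign matches the recursion
of `signedSum`. -/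
theorem partialSum_eq_signedSum {m : ℕ} {A : Type*} [AddCommGroup A] (g : A → ℂ[X]) (N : A)
    (K : Fin m → A) (k : ℕ) (hk : k ≤ m) (s : Fin k → Signs) :
    partialSum (S := fun _ => Signs) (fun t => g (N + ∑ i, (t i : ℤ) • K i)) k hk s =
      signedSum g (((List.finRange m).drop k).map K)
        (N + ∑ i, (s i : ℤ) • K (Fin.castLE hk i)) := by
  induction hr : m - k generalizing k with
  | zero =>
    obtain rfl : k = m := by omega
    rw [partialSum_self, List.drop_of_length_le (by simp)]
    rfl
  | succ r ih =>
    have hk' : k < m := by omega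
    have h1 : (List.finRange m).drop k = ⟨k, hk'⟩ :: (List.finRange m).drop (k + 1) := by
      rw [List.drop_eq_getElem_cons (by simpa using hk')]
      simp
    rw [partialSum_eq_sum_snoc _ k hk', h1, List.map_cons, signedSum]
    have h2 : ∀ a : Signs, partialSum (S := fun _ => Signs)
        (fun t => g (N + ∑ i, (t i : ℤ) • K i)) (k + 1) hk' (Fin.snoc s a) =
        signedSum g (((List.finRange m).drop (k + 1)).map K)
          (N + ∑ i, (s i : ℤ) • K (Fin.castLE hk i) + (a : ℤ) • K ⟨k, hk'⟩) := by
      intro a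
      rw [ih (k + 1) hk' _ (by omega), Fin.sum_univ_castSucc, ← add_assoc]
      simp only [Fin.snoc_castSucc, Fin.snoc_last]
      rfl
    have h3 : (Finset.univ : Finset Signs) = {⟨1, by simp⟩, ⟨-1, by simp⟩} := by decide
    refine (Finset.sum_congr rfl fun a _ => h2 a).trans ?_
    rw [h3, Finset.sum_pair (by decide)]
    simp [sub_eq_add_neg]

end PartialSum

/-! ### The Hermitian adjacency matrix as a signed sum of edge matrices -/

section HermitianAdjacency

variable {V : Type*} [DecidableEq V] {G T : SimpleGraph V} {m : ℕ}

open Classical in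
-- Swapping the ends of an edge negates both `σ` and `edgeMatrix`, so its term does not depend on
-- the chosen end.
theorem OutsideEdges.hermitianAdjMatrix_eq (e : OutsideEdges G T m)
    (σ : PartialOrientation G T) :
    hermitianAdjMatrix σ =
      T.adjMatrix ℂ + ∑ i, (e.signsOf σ i : ℤ) • edgeMatrix (e.u i) (e.v i) := by
  ext x y
  have hentry : ∀ i, ((e.signsOf σ i : ℤ) • edgeMatrix (e.u i) (e.v i)) x y =
      if s(e.u i, e.v i) = s(x, y) then Complex.I * (σ.σ x y : ℂ) else 0 := by
    intro i
    have hne := (e.adj i).1.ne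
    have hs : (e.signsOf σ i : ℤ) = σ.σ (e.u i) (e.v i) := rfl
    rw [hs]
    split_ifs with h
    · rcases Sym2.eq_iff.1 h with ⟨rfl, rfl⟩ | ⟨rfl, rfl⟩
      · simp [edgeMatrix, hne, mul_comm]
      · rw [σ.skew]
        simp [edgeMatrix, hne, mul_comm]
    · rw [Sym2.eq_iff, not_or] at h
      have h1 : ¬ (e.v i = x ∧ e.u i = y) := fun h' => h.2 ⟨h'.2, h'.1⟩
      simp [edgeMatrix, h.1, h1]
  rw [Matrix.add_apply, Matrix.sum_apply, Finset.sum_congr rfl fun i _ => hentry i]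
  by_cases hxy : G.Adj x y ∧ ¬ T.Adj x y
  · obtain ⟨i, hi⟩ := e.exists_index hxy.1 hxy.2
    have hi' : s(e.u i, e.v i) = s(x, y) := Sym2.eq_iff.2 hi
    rw [Finset.sum_eq_single i, if_pos hi']
    · simp [hermitianAdjMatrix, hxy]
    · intro j _ hj
      exact if_neg fun h => hj (e.injective (h.trans hi'.symm))
    · simp
  · rw [Finset.sum_eq_zero]
    · by_cases hT : T.Adj x y
      · simp [hermitianAdjMatrix, hT]
      · have hG : ¬ G.Adj x y := fun h => hxy ⟨h, hT⟩
        simp [hermitianAdjMatrix, hT, hG]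
    · intro i _
      refine if_neg fun h => hxy ?_
      have h1 := e.adj i
      rwa [← SimpleGraph.mem_edgeSet, ← SimpleGraph.mem_edgeSet, h, SimpleGraph.mem_edgeSet,
        SimpleGraph.mem_edgeSet] at h1

open Classical in
theorem OutsideEdges.signPoly_eq [Fintype V] (e : OutsideEdges G T m) :
    e.signPoly = fun s => (T.adjMatrix ℂ +
      ∑ i, (s i : ℤ) • edgeMatrix (e.u i) (e.v i)).charpoly := by
  funext s
  rw [OutsideEdges.signPoly, e.hermitianAdjMatrix_eq]
  have h : e.signsOf (e.correspondence.symm s) = s := e.correspondence.apply_symm_apply s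
  rw [h]

theorem SimpleGraph.isHermitian_adjMatrix_add_sum_edgeMatrix (T : SimpleGraph V)
    [DecidableRel T.Adj] {ι : Type*} (J : Finset ι) (s : ι → Signs) (u v : ι → V) :
    (T.adjMatrix ℂ + ∑ i ∈ J, (s i : ℤ) • edgeMatrix (u i) (v i)).IsHermitian := by
  have h0 : (T.adjMatrix ℂ).IsHermitian := by
    ext x y
    simp [T.adj_comm, apply_ite]
  refine h0.add ?_
  rw [Matrix.IsHermitian, Matrix.conjTranspose_sum]
  refine Finset.sum_congr rfl fun i _ => ?_
  rw [← Int.cast_smul_eq_zsmul ℂ, Matrix.conjTranspose_smul, (isHermitian_edgeMatrix _ _).eq]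
  simp

end HermitianAdjacency

/-! ### The interlacing family -/

theorem mainTheorem3 {V : Type*} [Fintype V] [DecidableEq V] (G T : SimpleGraph V)
    (hG : G.Connected) (hTG : T ≤ G) (hT : T.IsTree) {m : ℕ} (e : OutsideEdges G T m) :
    IsInterlacingFamily (S := fun _ : Fin m => Signs) e.signPoly := by
  classical
  have : Nonempty V := hG.nonempty
  rw [e.signPoly_eq]
  refine ⟨⟨Fintype.card V, fun s => ⟨?_, Matrix.charpoly_natDegree_eq_dim _, 1, one_pos, ?_⟩⟩, ?_⟩
  · exact (T.isHermitian_adjMatrix_add_sum_edgeMatrix _ _ _ _).realRooted_charpoly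
  · rw [Complex.ofReal_one]
    exact Matrix.charpoly_monic _
  · intro k hk s
    have key := hasCommonInterlacing_signedSum_charpoly
      (T.isHermitian_adjMatrix_add_sum_edgeMatrix Finset.univ s
        (fun i => e.u (Fin.castLE hk.le i)) fun i => e.v (Fin.castLE hk.le i))
      (e.adj ⟨k, hk⟩).1.ne
      (l := ((List.finRange m).drop (k + 1)).map fun i => (e.u i, e.v i)) (by
        intro p hp
        obtain ⟨i, -, rfl⟩ := List.mem_map.1 hp
        exact (e.adj i).1.ne)
    obtain ⟨g, hg⟩ := key
    refine ⟨g, fun ε => ?_⟩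
    convert hg ε using 1
    refine (partialSum_eq_signedSum Matrix.charpoly (T.adjMatrix ℂ)
      (fun i => edgeMatrix (e.u i) (e.v i)) (k + 1) hk (Fin.snoc s ε)).trans ?_
    rw [Fin.sum_univ_castSucc, ← add_assoc, List.map_map]
    simp only [Fin.snoc_castSucc, Fin.snoc_last]
    rfl
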